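/- Notation: for $a\in\mathbb{C}$ let $(a)_0=1$, $(a)_n=a(a+1)\cdots(a+n-1)$; let ${}_1F_1(a;b;z)=\sum_{k\ge0}\frac{(a)_k}{(b)_k}\frac{z^k}{k!}$, and let $L_n^{(\alpha)}(z)=\frac{(\alpha+1)_n}{n!}\,{}_1F_1(-n;\alpha+1;z)$ be the generalized Laguerre polynomials. A series $\sum_\mu u_\mu$ is called Abel summable to $s$ if $\sum_\mu u_\mu t^\mu$ converges for $0<t<1$ and tends to $s$ as $t\uparrow1$. Let $\alpha,\rho\in\mathbb{R}$ with $\rho\notin\mathbb{N}_0=\{0,1,2,\dots\}$, $\alpha>-1$ and $\alpha+2\rho>-1$. Put $$\lambda_n=\frac{\Gamma(\rho+\alpha+1)}{\Gamma(\alpha+1)}\,(-1)^n\frac{(-\rho)_n}{(\alpha+1)_n}\quad(n\in\mathbb{N}_0),\qquad F(z)=2^\rho\,\frac{\Gamma(\rho+\alpha+1)}{\Gamma(\alpha+1)}\;{}_1F_1\!\left(-\rho;\alpha+1;\tfrac z2\right).$$ Then: 1. $F$ is an entire function; in particular it is analytic at $z=0$. 2. The restriction of $F$ to $(0,\infty)$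 belongs to $L^2\big((0,\infty),\,x^\alpha e^{-x}\,dx\big)$, and the Laguerre series $G_\rho^{(\alpha)}=\sum_{n=0}^\infty\lambda_nL_n^{(\alpha)}$ converges to $F$ in the norm of this space. 3. The rearrangement of this Laguerre series into powers of $z$ yields $F$ if the inner series are summed in the sense of Abel: for every $\nu\in\mathbb{N}_0$ the series $\sum_{\mu\ge0}\frac{(\alpha+\nu+1)_\mu}{\mu!}\lambda_{\mu+\nu}$ is Abel summable to some real number $\gamma_\nu$, and $F(z)=\sum_{\nu\ge0}\frac{(-z)^\nu}{\nu!}\gamma_\nu$ for all $z\in\mathbb{C}$, with convergence. 4. For every $n\in\mathbb{N}_0$ the following integral converges absolutely and $$\int_0^\infty e^{-x}x^\alpha L_n^{(\alpha)}(x)\;{}_1F_1\!\left(-\rho;\alpha+1;\tfrac x2\right)dx=\frac{(-1)^n}{2^\rho}\,\frac{\Gamma(\alpha+1)\,(-\rho)_n}{n!};$$ consequently the Laguerre coefficients of $F$ are the $\lambda_n$, that is, $\frac{n!}{\Gamma(\alpha+n+1)}\int_0^\infty x^\alpha e^{-x}L_n^{(\alpha)}(x)F(x)\,dx=\lambda_n$.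 5. Although $F$ is analytic at the origin, these coefficients ultimately alternate in sign and decay only algebraically: $\alpha+\rho+1>0$, and $$(-1)^n\,n^{\alpha+\rho+1}\,\lambda_n\;\longrightarrow\;\frac{\Gamma(\rho+\alpha+1)}{\Gamma(-\rho)}\neq0\qquad(n\to\infty).$$ -/

import Mathlib

open Filter Topology MeasureTheory

namespace LaguerreSeries

/-- The confluent hypergeometric (Kummer) series
`₁F₁(a; b; z) = ∑ₖ (a)ₖ / (b)ₖ * zᵏ / k!`, where `(a)ₖ` is the Pochhammer symbol
(rising factorial). -/
noncomputable def kummer (a b z : ℂ) : ℂ :=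
  ∑' k : ℕ, (ascPochhammer ℂ k).eval a / (ascPochhammer ℂ k).eval b * (z ^ k / (k.factorial : ℂ))

/-- The generalized Laguerre polynomial
`Lₙ^{(α)}(z) = (α+1)ₙ / n! * ₁F₁(-n; α+1; z)` (a terminating series). -/
noncomputable def laguerre (α : ℝ) (n : ℕ) (z : ℂ) : ℂ :=
  (ascPochhammer ℂ n).eval ((α : ℂ) + 1) / (n.factorial : ℂ) * kummer (-(n : ℂ)) ((α : ℂ) + 1) z

/-- The measure `x^α e^{-x} dx` on the half-line `(0, ∞)`; `MemLp f 2` and `eLpNorm f 2` for this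
measure are membership in, and the norm of, the weighted `L²` space of Laguerre expansions. -/
noncomputable def weightMeasure (α : ℝ) : Measure ℝ :=
  (volume.restrict (Set.Ioi 0)).withDensity fun x => ENNReal.ofReal (x ^ α * Real.exp (-x))

/-- The Laguerre coefficient
`n! / Γ(α+n+1) * ∫₀^∞ x^α e^{-x} Lₙ^{(α)}(x) f(x) dx` of a function `f`. -/
noncomputable def laguerreCoeff (α : ℝ) (f : ℂ → ℂ) (n : ℕ) : ℂ :=
  ((n.factorial / Real.Gamma (α + n + 1) : ℝ) : ℂ) *
    ∫ x in Set.Ioi (0 : ℝ), ((Real.exp (-x) * x ^ α : ℝ) : ℂ) * laguerre α n x * f x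

/-- The coefficient `Γ(ρ+α+1)/Γ(α+1) * (-1)ⁿ (-ρ)ₙ / (α+1)ₙ` of `Lₙ^{(α)}` in the series
`G_ρ^{(α)}`. -/
noncomputable def coeffG (α ρ : ℝ) (n : ℕ) : ℝ :=
  Real.Gamma (ρ + α + 1) / Real.Gamma (α + 1) *
    ((-1) ^ n * ((ascPochhammer ℝ n).eval (-ρ) / (ascPochhammer ℝ n).eval (α + 1)))

/-- The function `2^ρ Γ(ρ+α+1)/Γ(α+1) ₁F₁(-ρ; α+1; z/2)`. -/
noncomputable def closedG (α ρ : ℝ) (z : ℂ) : ℂ :=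
  (((2 : ℝ) ^ ρ * (Real.Gamma (ρ + α + 1) / Real.Gamma (α + 1)) : ℝ) : ℂ) *
    kummer (-(ρ : ℂ)) ((α : ℂ) + 1) (z / 2)

/-- The series `∑ uₙ` is Abel summable to `s`: `∑ uₙ tⁿ` converges for `0 < t < 1` and tends
to `s` as `t ↑ 1`. -/
def AbelSum (u : ℕ → ℝ) (s : ℝ) : Prop :=
  (∀ t ∈ Set.Ioo (0 : ℝ) 1, Summable fun n => u n * t ^ n) ∧
    Tendsto (fun t : ℝ => ∑' n, u n * t ^ n) (𝓝[<] 1) (𝓝 s)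

end LaguerreSeries

namespace LaguerreSeries

/-! Everything rests on the dilated series `∑ λₙ tⁿ Lₙ` with `0 ≤ t < 1`. Expanding each `Lₙ` in
powers of `x` gives an absolutely convergent double series. Collected by powers of `x`, its inner
sums are binomial series with value `λ_ν (1 + t)^(ρ - ν)` (`hasSum_abel`), and the outer sum is a
Kummer series in `x t / (1 + t)` (`hasSum_laguerre_abel`). The inner values are continuous at `t =
1`; this gives the Abel sums, and the closed form at `t = 1` is `F`.

Mean convergence needs no completeness of the Laguerre system. Orthogonality, a consequence of
Chu–Vandermonde, turns the squared norm of a finite block of the dilated series into a sum of `λₙ²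
t²ⁿ Γ(α+n+1)/n!`, bounded uniformly in `t`. Fatou's lemma, applied as the block grows and again as
`t` tends to 1, bounds the distance from `F` to a partial sum by a tail of `∑ λₙ² Γ(α+n+1)/n!`
(`eLpNorm_closedReal_sub_le`). Euler's limit for the Gamma function shows that these terms have
order `n^(-(α+2ρ+2))`, so the tails vanish. The coefficient integrals then follow from mean
convergence and Hölder's inequality. -/

/-! ### Pochhammer symbols, Gamma quotients and the binomial series -/

/-- The Pochhammer symbol `(a)ₙ` of a real number. -/
noncomputable def rising (a : ℝ) (n : ℕ) : ℝ := (ascPochhammer ℝ n).eval a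

theorem ofReal_rising (a : ℝ) (n : ℕ) :
    ((rising a n : ℝ) : ℂ) = (ascPochhammer ℂ n).eval (a : ℂ) := by
  induction n with
  | zero => simp [rising]
  | succ n ih =>
    rw [rising] at ih ⊢
    rw [ascPochhammer_succ_eval, ascPochhammer_succ_eval, ← ih]
    push_cast; ring

@[simp] theorem rising_zero (a : ℝ) : rising a 0 = 1 := by simp [rising]

theorem rising_succ (a : ℝ) (n : ℕ) : rising a (n + 1) = rising a n * (a + n) :=
  ascPochhammer_succ_eval n a

theorem rising_succ_left (a : ℝ) (n : ℕ) : rising a (n + 1) = a * rising (a + 1) n := by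
  simp [rising, ascPochhammer_succ_left, Polynomial.eval_comp]

theorem rising_add (a : ℝ) (m n : ℕ) : rising a (m + n) = rising a m * rising (a + m) n := by
  simp [rising, ← ascPochhammer_mul, Polynomial.eval_comp]

theorem rising_pos {a : ℝ} (ha : 0 < a) (n : ℕ) : 0 < rising a n := ascPochhammer_pos n a ha

theorem rising_one (n : ℕ) : rising 1 n = n.factorial := by
  simp [rising]

theorem abs_rising_le (a : ℝ) (n : ℕ) : |rising a n| ≤ rising |a| n := by
  induction n with
  | zero => simp
  | succ n ih =>
    rw [rising_succ, rising_succ, abs_mul]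
    have : |a + n| ≤ |a| + n := (abs_add_le _ _).trans (by simp)
    gcongr
    exact (abs_nonneg _).trans ih

theorem rising_mono {a b : ℝ} (ha : 0 ≤ a) (hab : a ≤ b) (n : ℕ) :
    0 ≤ rising a n ∧ rising a n ≤ rising b n := by
  induction n with
  | zero => simp
  | succ n ih =>
    rw [rising_succ, rising_succ]
    have := ih.1
    exact ⟨by positivity, by gcongr; exact ih.1.trans ih.2; exact ih.2⟩

/-- Each factor `(a + j) / (b + j)` is at most `|a| / b + 1` in absolute value. The bound is crude,
but geometric growth is absorbed by the `1 / k!` of the Kummer series. -/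
theorem abs_rising_div_le (a : ℝ) {b : ℝ} (hb : 0 < b) (n : ℕ) :
    |rising a n / rising b n| ≤ (|a| / b + 1) ^ n := by
  induction n with
  | zero => simp
  | succ n ih =>
    rw [rising_succ, rising_succ, mul_div_mul_comm, abs_mul, pow_succ]
    have hn : (0 : ℝ) < b + n := by positivity
    have : |(a + n) / (b + n)| ≤ |a| / b + 1 := by
      rw [abs_div, abs_of_pos hn, div_le_iff₀ hn]
      have h1 : |a + n| ≤ |a| + n := (abs_add_le _ _).trans (by simp)
      have h2 : (|a| / b + 1) * (b + n) = |a| + n + (b + |a| / b * n) := by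
        field_simp; ring
      have : 0 ≤ b + |a| / b * n := by positivity
      linarith
    gcongr

theorem rising_neg_natCast (n k : ℕ) (hk : k ≤ n) :
    rising (-(n : ℝ)) k = (-1) ^ k * n.choose k * k.factorial := by
  induction k with
  | zero => simp
  | succ k ih =>
    rw [rising_succ, ih (by omega)]
    have h := Nat.choose_succ_right_eq n k
    have h' : (n.choose (k + 1) : ℝ) * (k + 1) = n.choose k * (n - k) := by
      rw [← Nat.cast_sub (by omega)]; exact_mod_cast h
    rw [Nat.factorial_succ]; push_cast
    linear_combination (-1) ^ k * (k.factorial : ℝ) * h'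

theorem rising_neg_natCast_of_lt {n k : ℕ} (hk : n < k) : rising (-(n : ℝ)) k = 0 :=
  ascPochhammer_eval_neg_coe_nat_of_lt hk

/-- The Chu–Vandermonde identity. -/
theorem sum_choose_rising (n : ℕ) (x a : ℝ) :
    ∑ j ∈ Finset.range (n + 1), (n.choose j : ℝ) * ((-1) ^ j * rising x j * rising (a + j) (n - j)) =
      rising (a - x) n := by
  induction n generalizing a with
  | zero => simp
  | succ n ih =>
    have key := Finset.sum_antidiagonal_choose_succ_mul
      (fun i j => (-1) ^ i * rising x i * rising (a + i) j) n
    rw [Finset.Nat.sum_antidiagonal_eq_sum_range_succ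
        (fun i j => ((n + 1).choose i : ℝ) * ((-1) ^ i * rising x i * rising (a + i) j)),
      Finset.Nat.sum_antidiagonal_eq_sum_range_succ
        (fun i j => (n.choose i : ℝ) * ((-1) ^ i * rising x i * rising (a + i) (j + 1))),
      Finset.Nat.sum_antidiagonal_eq_sum_range_succ
        (fun i j => (n.choose j : ℝ) * ((-1) ^ (i + 1) * rising x (i + 1) * rising (a + (i + 1 : ℕ)) j)),
      ← Finset.sum_add_distrib] at key
    -- After Pascal's rule, paired terms share `(x)ⱼ (a+j+1)ₙ₋ⱼ`, and the remaining factors combine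
    -- to `(a + j) - (x + j) = a - x`.
    rw [key, rising_succ_left, show a - x + 1 = (a + 1) - x by ring, ← ih (a + 1), Finset.mul_sum]
    refine Finset.sum_congr rfl fun j hj => ?_
    rw [Nat.choose_symm (by simpa [Nat.lt_succ_iff] using hj), rising_succ_left, rising_succ,
      show a + 1 + (j : ℝ) = a + j + 1 by ring, show a + ((j + 1 : ℕ) : ℝ) = a + j + 1 by push_cast; ring]
    ring

theorem Gamma_add_natCast {a : ℝ} (ha : 0 < a) (n : ℕ) :
    Real.Gamma (a + n) = Real.Gamma a * rising a n := by
  induction n with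
  | zero => simp
  | succ n ih =>
    rw [rising_succ, ← mul_assoc, ← ih]; push_cast
    rw [← add_assoc, Real.Gamma_add_one (by positivity), mul_comm]

theorem GammaSeq_eq (s : ℝ) (n : ℕ) :
    Real.GammaSeq s n = (n : ℝ) ^ s * n.factorial / (rising s n * (s + n)) := by
  rw [Real.GammaSeq, ← rising_succ]
  congr 1
  generalize n + 1 = m
  induction m with
  | zero => simp
  | succ m ih => rw [Finset.prod_range_succ, ih, rising_succ]

/-- The binomial series. -/
theorem hasSum_rising (a : ℝ) {x : ℝ} (hx : |x| < 1) :
    HasSum (fun k : ℕ => rising a k / k.factorial * x ^ k) ((1 - x) ^ (-a)) := by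
  have h := (Real.one_div_one_sub_rpow_hasFPowerSeriesOnBall_zero a).hasSum
    (y := x) (by simpa [enorm_eq_nnnorm] using! hx)
  have h0 : 0 < 1 - x := by linarith [(abs_lt.1 hx).2]
  rw [Real.rpow_neg h0.le, ← one_div]
  have hc : ∀ k : ℕ, Ring.choose (a + k - 1) k = rising a k / k.factorial := fun k => by
    rw [eq_div_iff (by positivity), ← Ring.multichoose_eq, mul_comm, ← nsmul_eq_mul,
      Ring.factorial_nsmul_multichoose_eq_ascPochhammer, Polynomial.ascPochhammer_smeval_eq_eval,
      rising]
  simpa [hc, mul_comm] using h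

/-! ### The Kummer function -/

/-- The Kummer function with real parameters and argument. -/
noncomputable def kummerReal (a b x : ℝ) : ℝ :=
  ∑' k : ℕ, rising a k / rising b k * (x ^ k / (k.factorial : ℝ))

theorem ofReal_kummerReal (a b x : ℝ) : (kummerReal a b x : ℂ) = kummer a b x := by
  rw [kummerReal, kummer, Complex.ofReal_tsum]
  congr 1; funext k
  push_cast [← ofReal_rising]; rfl

theorem norm_kummer_term_le (a : ℝ) {b : ℝ} (hb : 0 < b) (z : ℂ) (k : ℕ) :
    ‖(ascPochhammer ℂ k).eval (a : ℂ) / (ascPochhammer ℂ k).eval (b : ℂ) *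
      (z ^ k / (k.factorial : ℂ))‖ ≤ ((|a| / b + 1) * ‖z‖) ^ k / k.factorial := by
  rw [← ofReal_rising, ← ofReal_rising, ← Complex.ofReal_div, norm_mul, Complex.norm_real,
    norm_div (z ^ k), norm_pow, Complex.norm_natCast, mul_pow, mul_div_assoc]
  gcongr
  exact abs_rising_div_le a hb k

theorem hasSum_kummer (a : ℝ) {b : ℝ} (hb : 0 < b) (z : ℂ) :
    HasSum (fun k : ℕ => (ascPochhammer ℂ k).eval (a : ℂ) / (ascPochhammer ℂ k).eval (b : ℂ) *
      (z ^ k / (k.factorial : ℂ))) (kummer a b z) :=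
  (Summable.of_norm_bounded (Real.summable_pow_div_factorial _)
    (norm_kummer_term_le a hb z)).hasSum

theorem differentiable_kummer (a : ℝ) {b : ℝ} (hb : 0 < b) : Differentiable ℂ (kummer a b) := by
  intro z
  -- The Weierstrass M-test on a ball containing `z`; the majorant is an exponential series.
  have h : DifferentiableOn ℂ (kummer a b) (Metric.ball 0 (‖z‖ + 1)) := by
    refine Complex.differentiableOn_tsum_of_summable_norm
      (u := fun k => ((|a| / b + 1) * (‖z‖ + 1)) ^ k / k.factorial)
      (Real.summable_pow_div_factorial _) (fun k => by fun_prop) Metric.isOpen_ball ?_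
    intro k w hw
    refine (norm_kummer_term_le a hb w k).trans ?_
    have : ‖w‖ ≤ ‖z‖ + 1 := by simpa using (mem_ball_zero_iff.1 hw).le
    gcongr
  exact h.differentiableAt (Metric.isOpen_ball.mem_nhds (by simp))

theorem continuous_kummerReal (a : ℝ) {b : ℝ} (hb : 0 < b) : Continuous (kummerReal a b) := by
  have : kummerReal a b = fun x : ℝ => (kummer a b x).re := by
    funext x; rw [← ofReal_kummerReal, Complex.ofReal_re]
  rw [this]
  exact Complex.continuous_re.comp ((differentiable_kummer a hb).continuous.comp
    Complex.continuous_ofReal)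

/-! ### Laguerre polynomials -/

/-- The generalized Laguerre polynomial of a real argument. -/
noncomputable def laguerreReal (α : ℝ) (n : ℕ) (x : ℝ) : ℝ :=
  ∑ j ∈ Finset.range (n + 1),
    (-x) ^ j / j.factorial * (rising (α + j + 1) (n - j) / (n - j).factorial)

theorem ofReal_laguerreReal {α : ℝ} (hα : -1 < α) (n : ℕ) (x : ℝ) :
    (laguerreReal α n x : ℂ) = laguerre α n x := by
  have h1 : laguerre α n x = ((rising (α + 1) n / n.factorial * kummerReal (-n) (α + 1) x : ℝ) : ℂ) := by
    rw [laguerre]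
    push_cast [ofReal_rising, ofReal_kummerReal]
    rfl
  rw [h1, kummerReal, tsum_eq_sum (s := Finset.range (n + 1)), laguerreReal, Finset.mul_sum]
  · congr 1
    refine Finset.sum_congr rfl fun j hj => ?_
    have hj : j ≤ n := by simpa [Nat.lt_succ_iff] using hj
    rw [rising_neg_natCast n j hj, Nat.cast_choose ℝ hj]
    have h2 : rising (α + 1) n = rising (α + 1) j * rising (α + j + 1) (n - j) := by
      conv_lhs => rw [← Nat.add_sub_cancel' hj, rising_add]
      rw [add_right_comm]
    have h3 := (rising_pos (show 0 < α + 1 by linarith) j).ne'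
    rw [h2, neg_pow x]
    field_simp
  · intro k hk
    rw [rising_neg_natCast_of_lt (by simpa using hk)]
    simp

theorem continuous_laguerreReal (α : ℝ) (n : ℕ) : Continuous (laguerreReal α n) := by
  unfold laguerreReal; fun_prop

theorem rising_ne_zero {a : ℝ} (ha : ∀ m : ℕ, a ≠ -m) (n : ℕ) : rising a n ≠ 0 := by
  induction n with
  | zero => simp
  | succ n ih =>
    rw [rising_succ]
    exact mul_ne_zero ih fun h => ha n (by linarith)

theorem coeffG_eq (α ρ : ℝ) (n : ℕ) :
    coeffG α ρ n = Real.Gamma (ρ + α + 1) / Real.Gamma (α + 1) *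
      ((-1) ^ n * (rising (-ρ) n / rising (α + 1) n)) := rfl

theorem closedG_ofReal (α ρ x : ℝ) :
    closedG α ρ x = (((2 : ℝ) ^ ρ * (Real.Gamma (ρ + α + 1) / Real.Gamma (α + 1)) *
      kummerReal (-ρ) (α + 1) (x / 2) : ℝ) : ℂ) := by
  rw [closedG, Complex.ofReal_mul _ (kummerReal _ _ _), ofReal_kummerReal]
  push_cast; rfl

theorem differentiable_closedG {α : ℝ} (hα : -1 < α) (ρ : ℝ) :
    Differentiable ℂ (closedG α ρ) := by
  have h := differentiable_kummer (-ρ) (show 0 < α + 1 by linarith)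
  push_cast at h
  unfold closedG
  exact (h.comp (differentiable_id.div_const 2)).const_mul _

/-! ### Asymptotics of the coefficients -/

/-- The quotient of Euler's limits for `Γ(b)` and `Γ(a)`: the factorials cancel, and the surplus
factor `(a + n) / (b + n)` tends to 1. -/
theorem tendsto_rising_div (a b : ℝ) (ha : ∀ m : ℕ, a ≠ -m) (hb : ∀ m : ℕ, b ≠ -m) :
    Tendsto (fun n : ℕ => rising a n / rising b n * (n : ℝ) ^ (b - a)) atTop
      (𝓝 (Real.Gamma b / Real.Gamma a)) := by
  have h1 := (Real.GammaSeq_tendsto_Gamma b).div (Real.GammaSeq_tendsto_Gamma a)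
    (Real.Gamma_ne_zero ha)
  have h2 : Tendsto (fun n : ℕ => (b + (n : ℝ)) / (a + n)) atTop (𝓝 1) := by
    have h3 : Tendsto (fun n : ℕ => (b - a) / (a + (n : ℝ))) atTop (𝓝 0) :=
      tendsto_const_nhds.div_atTop
        (tendsto_atTop_add_const_left _ _ tendsto_natCast_atTop_atTop)
    have h4 := h3.const_add 1
    rw [add_zero] at h4
    refine h4.congr fun n => ?_
    have : a + (n : ℝ) ≠ 0 := fun h => ha n (by linarith)
    field_simp; ring
  have h5 := h1.mul h2
  rw [mul_one] at h5
  refine h5.congr' ?_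
  filter_upwards [eventually_gt_atTop 0] with n hn
  have hn' : (0 : ℝ) < n := by exact_mod_cast hn
  simp only [Pi.div_apply]
  rw [GammaSeq_eq, GammaSeq_eq, Real.rpow_sub hn']
  have e1 : a + (n : ℝ) ≠ 0 := fun h => ha n (by linarith)
  have e2 : b + (n : ℝ) ≠ 0 := fun h => hb n (by linarith)
  have e3 := rising_ne_zero ha n
  have e4 := rising_ne_zero hb n
  have e5 := (Real.rpow_pos_of_pos hn' a).ne'
  have e6 : (n.factorial : ℝ) ≠ 0 := by positivity
  field_simp

theorem tendsto_coeffG {α ρ : ℝ} (hρ : ∀ m : ℕ, ρ ≠ m) (hα : -1 < α) :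
    Tendsto (fun n : ℕ => (-1) ^ n * coeffG α ρ n * (n : ℝ) ^ (α + ρ + 1)) atTop
      (𝓝 (Real.Gamma (ρ + α + 1) / Real.Gamma (-ρ))) := by
  have h := (tendsto_rising_div (-ρ) (α + 1) (fun m h => hρ m (by linarith))
    (fun m h => by have : (0 : ℝ) ≤ m := by positivity
                   linarith)).const_mul (Real.Gamma (ρ + α + 1) / Real.Gamma (α + 1))
  have hG : Real.Gamma (α + 1) ≠ 0 := (Real.Gamma_pos_of_pos (by linarith)).ne'
  rw [div_mul_div_cancel₀ hG] at h
  refine h.congr fun n => ?_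
  rw [coeffG_eq, show α + 1 - -ρ = α + ρ + 1 by ring]
  have : ((-1 : ℝ) ^ n) * (-1) ^ n = 1 := by rw [← mul_pow]; norm_num
  linear_combination (-(Real.Gamma (ρ + α + 1) / Real.Gamma (α + 1) *
      (rising (-ρ) n / rising (α + 1) n) * (n : ℝ) ^ (α + ρ + 1))) * this

/-- The squared norms of the terms of the Laguerre series are summable. -/
theorem summable_coeffG_sq {α ρ : ℝ} (hρ : ∀ m : ℕ, ρ ≠ m) (hα : -1 < α)
    (hαρ : -1 < α + 2 * ρ) :
    Summable fun n : ℕ => coeffG α ρ n ^ 2 * (Real.Gamma (α + n + 1) / n.factorial) := by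
  have h1 := (tendsto_coeffG hρ hα).pow 2
  have h2 := tendsto_rising_div (α + 1) 1
    (fun m h => by have : (0 : ℝ) ≤ m := by positivity
                   linarith)
    (fun m h => by have : (0 : ℝ) ≤ m := by positivity
                   linarith)
  have h3 := (h1.mul h2).isBigO_one ℝ
  -- `λₙ²` has order `n^(-2(α+ρ+1))` and `Γ(α+n+1)/n!` has order `n^α`. The resulting exponent is
  -- below `-1` exactly when `α + 2ρ > -1`.
  refine summable_of_isBigO_nat (g := fun n : ℕ => (n : ℝ) ^ (-(α + 2 * ρ + 2)))
    (Real.summable_nat_rpow.2 (by linarith)) ?_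
  have h4 := (h3.const_mul_left (Real.Gamma (α + 1))).mul
    (Asymptotics.isBigO_refl (fun n : ℕ => (n : ℝ) ^ (-(α + 2 * ρ + 2))) atTop)
  simp only [one_mul] at h4
  refine h4.congr' ?_ .rfl
  filter_upwards [eventually_gt_atTop 0] with n hn
  have hn' : (0 : ℝ) < n := by exact_mod_cast hn
  rw [add_right_comm α (n : ℝ), Gamma_add_natCast (by linarith), rising_one]
  have e1 : ((-1 : ℝ) ^ n) ^ 2 = 1 := by rw [← pow_mul, mul_comm, pow_mul]; norm_num
  have e2 : ((n : ℝ) ^ (α + ρ + 1)) ^ 2 * (n : ℝ) ^ (1 - (α + 1)) *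
      (n : ℝ) ^ (-(α + 2 * ρ + 2)) = 1 := by
    rw [← Real.rpow_mul_natCast hn'.le, ← Real.rpow_add hn', ← Real.rpow_add hn',
      show (α + ρ + 1) * (2 : ℕ) + (1 - (α + 1)) + -(α + 2 * ρ + 2) = 0 by push_cast; ring,
      Real.rpow_zero]
  linear_combination (Real.Gamma (α + 1) * rising (α + 1) n / n.factorial * coeffG α ρ n ^ 2) *
    (((-1 : ℝ) ^ n) ^ 2 * e2 + e1)

/-! ### Abel summation -/

/-- The denominators `(α+1)_{μ+ν}` cancel: `(α+ν+1)_μ λ_{μ+ν} = λ_ν (-1)^μ (ν-ρ)_μ`, which leaves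
the binomial series at `-t`. -/
theorem hasSum_abel {α : ℝ} (hα : -1 < α) (ρ : ℝ) (ν : ℕ) {t : ℝ} (ht : |t| < 1) :
    HasSum (fun μ : ℕ => rising (α + ν + 1) μ / μ.factorial * coeffG α ρ (μ + ν) * t ^ μ)
      (coeffG α ρ ν * (1 + t) ^ (ρ - ν)) := by
  have h := (hasSum_rising (-ρ + ν) (x := -t) (by rwa [abs_neg])).mul_left (coeffG α ρ ν)
  rw [sub_neg_eq_add, neg_add_rev, neg_neg, add_comm (-(ν : ℝ)), ← sub_eq_add_neg] at h
  refine h.congr_fun ?_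
  intro μ
  rw [coeffG_eq, coeffG_eq, add_comm μ ν, rising_add, rising_add, pow_add, neg_pow t,
    show α + 1 + (ν : ℝ) = α + ν + 1 by ring]
  have h1 := (rising_pos (show 0 < α + 1 by linarith) ν).ne'
  have h2 := (rising_pos (show 0 < α + ν + 1 by have : (0 : ℝ) ≤ ν := by positivity
                                                linarith) μ).ne'
  field_simp

theorem abelSum_coeffG {α : ℝ} (hα : -1 < α) (ρ : ℝ) (ν : ℕ) :
    AbelSum (fun μ => rising (α + ν + 1) μ / μ.factorial * coeffG α ρ (μ + ν))
      (coeffG α ρ ν * 2 ^ (ρ - ν)) := by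
  have habs : ∀ t ∈ Set.Ioo (0 : ℝ) 1, |t| < 1 := fun t ht => by rw [abs_of_pos ht.1]; exact ht.2
  refine ⟨fun t ht => (hasSum_abel hα ρ ν (habs t ht)).summable, ?_⟩
  have h : Tendsto (fun t : ℝ => coeffG α ρ ν * (1 + t) ^ (ρ - ν)) (𝓝[<] 1)
      (𝓝 (coeffG α ρ ν * 2 ^ (ρ - ν))) := by
    have : ContinuousAt (fun t : ℝ => coeffG α ρ ν * (1 + t) ^ (ρ - ν)) 1 :=
      continuousAt_const.mul ((continuousAt_const.add continuousAt_id).rpow_const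
        (Or.inl (by norm_num)))
    convert this.tendsto.mono_left nhdsWithin_le_nhds using 2
    norm_num
  refine h.congr' ?_
  filter_upwards [Ioo_mem_nhdsLT (show (0 : ℝ) < 1 by norm_num)] with t ht
  exact (hasSum_abel hα ρ ν (habs t ht)).tsum_eq.symm

theorem coeffG_mul_rpow (α ρ s : ℝ) (hs : 0 < s) (z : ℂ) (ν : ℕ) :
    (-z) ^ ν / (ν.factorial : ℂ) * ((coeffG α ρ ν * s ^ (ρ - ν) : ℝ) : ℂ) =
      ((s ^ ρ * (Real.Gamma (ρ + α + 1) / Real.Gamma (α + 1)) : ℝ) : ℂ) *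
        ((ascPochhammer ℂ ν).eval ((-ρ : ℝ) : ℂ) / (ascPochhammer ℂ ν).eval ((α + 1 : ℝ) : ℂ) *
          ((z / s) ^ ν / (ν.factorial : ℂ))) := by
  rw [coeffG_eq, ← ofReal_rising, ← ofReal_rising, Real.rpow_sub hs, Real.rpow_natCast, neg_pow z,
    div_pow]
  have : ((-1 : ℂ) ^ ν) * (-1) ^ ν = 1 := by rw [← mul_pow]; norm_num
  push_cast
  simp only [div_eq_mul_inv]
  linear_combination (z ^ ν * (ν.factorial : ℂ)⁻¹ * (((s ^ ρ : ℝ) : ℂ) * ((s : ℂ) ^ ν)⁻¹) *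
    (((Real.Gamma (ρ + α + 1) : ℝ) : ℂ) * ((Real.Gamma (α + 1) : ℝ) : ℂ)⁻¹) *
    ((rising (-ρ) ν : ℝ) : ℂ) * ((rising (α + 1) ν : ℝ) : ℂ)⁻¹) * this

/-- The parameter `s` serves two purposes: `s = 2` gives the closed form itself, `s = 1 + t` the
dilated series. -/
theorem hasSum_rearranged {α : ℝ} (hα : -1 < α) (ρ s : ℝ) (hs : 0 < s) (z : ℂ) :
    HasSum (fun ν : ℕ => (-z) ^ ν / (ν.factorial : ℂ) * ((coeffG α ρ ν * s ^ (ρ - ν) : ℝ) : ℂ))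
      (((s ^ ρ * (Real.Gamma (ρ + α + 1) / Real.Gamma (α + 1)) : ℝ) : ℂ) *
        kummer ((-ρ : ℝ) : ℂ) ((α + 1 : ℝ) : ℂ) (z / s)) := by
  simp_rw [coeffG_mul_rpow α ρ s hs]
  exact (hasSum_kummer _ (by linarith) _).mul_left _

theorem hasSum_rearranged_real {α : ℝ} (hα : -1 < α) (ρ s : ℝ) (hs : 0 < s) (x : ℝ) :
    HasSum (fun ν : ℕ => (-x) ^ ν / (ν.factorial : ℝ) * (coeffG α ρ ν * s ^ (ρ - ν)))
      (s ^ ρ * (Real.Gamma (ρ + α + 1) / Real.Gamma (α + 1)) *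
        kummerReal (-ρ) (α + 1) (x / s)) := by
  have h := hasSum_rearranged hα ρ s hs x
  rw [← Complex.hasSum_ofReal]
  convert h using 1
  · funext ν; push_cast; rfl
  · rw [Complex.ofReal_mul, ofReal_kummerReal]; push_cast; rfl

/-- The dilated series `∑ λₙ tⁿ Lₙ` in closed form. -/
theorem hasSum_laguerre_abel {α : ℝ} (hα : -1 < α) (ρ x : ℝ) {t : ℝ} (ht0 : 0 ≤ t) (ht1 : t < 1) :
    HasSum (fun n : ℕ => coeffG α ρ n * t ^ n * laguerreReal α n x)
      ((1 + t) ^ ρ * (Real.Gamma (ρ + α + 1) / Real.Gamma (α + 1)) *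
        kummerReal (-ρ) (α + 1) (x * t / (1 + t))) := by
  have hα' : 0 < α + 1 := by linarith
  have ht : |t| < 1 := by rwa [abs_of_nonneg ht0]
  -- Here `p.1` is the power of `x` and `p.1 + p.2` the Laguerre index `n`, so `tⁿ` splits between
  -- the two factors.
  set f : ℕ × ℕ → ℝ := fun p => (-(x * t)) ^ p.1 / p.1.factorial *
    (rising (α + p.1 + 1) p.2 / p.2.factorial * coeffG α ρ (p.2 + p.1) * t ^ p.2) with hf
  set C := |Real.Gamma (ρ + α + 1) / Real.Gamma (α + 1)|
  set M := |-ρ| / (α + 1) + 1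
  -- Majorant of `f`: replacing `-ρ + j` by `|ρ| + j` keeps each row a binomial series, and the row
  -- sums form an exponential series.
  set g : ℕ × ℕ → ℝ := fun p => (C * ((M * |x * t|) ^ p.1 / p.1.factorial)) *
    (rising (|ρ| + p.1) p.2 / p.2.factorial * t ^ p.2) with hg
  have hrow : ∀ j : ℕ, HasSum (fun μ => g (j, μ))
      ((C * ((M * |x * t|) ^ j / j.factorial)) * (1 - t) ^ (-(|ρ| + j))) := fun j =>
    (hasSum_rising _ ht).mul_left _
  have hM : 0 ≤ M := by positivity
  have hrn : ∀ j μ : ℕ, 0 ≤ rising (|ρ| + j) μ := fun j μ =>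
    (rising_mono (by positivity) le_rfl μ).1
  have hg0 : 0 ≤ g := fun p => by
    have := hrn p.1 p.2
    simp only [hg, Pi.zero_apply]; positivity
  have hgs : Summable g := by
    rw [summable_prod_of_nonneg hg0]
    refine ⟨fun j => (hrow j).summable, ?_⟩
    simp_rw [(hrow _).tsum_eq]
    have h1 : 0 < 1 - t := by linarith
    refine ((Real.summable_pow_div_factorial (M * |x * t| * (1 - t)⁻¹)).mul_left
      (C * (1 - t) ^ (-|ρ|))).congr fun j => ?_
    rw [neg_add, Real.rpow_add h1, Real.rpow_neg h1.le j, Real.rpow_natCast, mul_pow _ (1 - t)⁻¹,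
      inv_pow]
    ring
  have hfs : Summable f := by
    refine Summable.of_norm_bounded hgs fun p => ?_
    obtain ⟨j, μ⟩ := p
    have e1 := (rising_pos hα' j).ne'
    have e2 := (rising_pos (show 0 < α + j + 1 by have : (0 : ℝ) ≤ j := by positivity
                                                  linarith) μ).ne'
    have e : f (j, μ) = (Real.Gamma (ρ + α + 1) / Real.Gamma (α + 1)) *
        ((rising (-ρ) j / rising (α + 1) j) * ((-(x * t)) ^ j / j.factorial)) *
        (rising (-ρ + j) μ / μ.factorial * ((-1) ^ (j + μ) * t ^ μ)) := by
      simp only [hf]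
      rw [coeffG_eq, add_comm μ j, rising_add, rising_add, show α + 1 + (j : ℝ) = α + j + 1 by ring]
      field_simp
    rw [e, Real.norm_eq_abs]
    simp only [abs_mul, abs_div (_ ^ _), abs_div (rising (-ρ + j) μ), abs_pow, abs_neg, abs_one,
      one_pow, one_mul, Nat.abs_cast, abs_of_nonneg ht0, hg, mul_pow]
    have b1 := abs_rising_div_le (-ρ) hα' j
    have b2 : |rising (-ρ + j) μ| ≤ rising (|ρ| + j) μ :=
      (abs_rising_le _ _).trans (rising_mono (abs_nonneg _)
        ((abs_add_le _ _).trans (by simp)) μ).2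
    rw [mul_div_assoc]
    gcongr
    exact (mul_le_mul_of_nonneg_right b1 (by positivity)).trans (le_of_eq (by simp only [M]; ring))
  have hsum : HasSum f ((1 + t) ^ ρ * (Real.Gamma (ρ + α + 1) / Real.Gamma (α + 1)) *
        kummerReal (-ρ) (α + 1) (x * t / (1 + t))) := by
    have h1 := hfs.hasSum.prod_fiberwise fun j => (hasSum_abel hα ρ j ht).mul_left
      ((-(x * t)) ^ j / j.factorial)
    rw [← h1.unique (hasSum_rearranged_real hα ρ (1 + t) (by linarith) (x * t))]
    exact hfs.hasSum
  -- Rows gave the Kummer function; summing the same family along the diagonals `p.1 + p.2 = n`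
  -- gives the Laguerre terms.
  rw [← Finset.HasAntidiagonal.sigmaAntidiagonalEquivProd.hasSum_iff] at hsum
  have h2 := hsum.sigma fun n => hasSum_fintype _
  refine h2.congr_fun fun n => ?_
  rw [laguerreReal, ← Finset.Nat.sum_antidiagonal_eq_sum_range_succ
    (fun i j => (-x) ^ i / i.factorial * (rising (α + i + 1) j / j.factorial)), Finset.mul_sum]
  simp only [Function.comp_apply, Finset.HasAntidiagonal.sigmaAntidiagonalEquivProd_apply]
  rw [Finset.sum_coe_sort (Finset.HasAntidiagonal.antidiagonal n) f]
  refine Finset.sum_congr rfl fun p hp => ?_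
  rw [Finset.HasAntidiagonal.mem_antidiagonal] at hp
  subst hp
  simp only [hf, add_comm p.2 p.1, pow_add, ← neg_mul, mul_pow]
  ring

/-! ### The weighted space -/

theorem measurable_weight (α : ℝ) :
    Measurable fun x : ℝ => ENNReal.ofReal (x ^ α * Real.exp (-x)) := by fun_prop

theorem toReal_weight {α x : ℝ} (hx : 0 < x) :
    (ENNReal.ofReal (x ^ α * Real.exp (-x))).toReal = Real.exp (-x) * x ^ α := by
  rw [ENNReal.toReal_ofReal (by positivity), mul_comm]

theorem integrable_weightMeasure_iff {E : Type*} [NormedAddCommGroup E] [NormedSpace ℝ E] (α : ℝ)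
    (f : ℝ → E) : Integrable f (weightMeasure α) ↔
      IntegrableOn (fun x => (Real.exp (-x) * x ^ α) • f x) (Set.Ioi 0) := by
  rw [weightMeasure, integrable_withDensity_iff_integrable_smul' (measurable_weight α) (by simp)]
  refine integrableOn_congr_fun (fun x hx => ?_) measurableSet_Ioi
  simp only [toReal_weight hx]

theorem integral_weightMeasure {E : Type*} [NormedAddCommGroup E] [NormedSpace ℝ E] (α : ℝ)
    (f : ℝ → E) : ∫ x, f x ∂(weightMeasure α) =
      ∫ x in Set.Ioi 0, (Real.exp (-x) * x ^ α) • f x := by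
  rw [weightMeasure, integral_withDensity_eq_integral_toReal_smul (measurable_weight α) (by simp)]
  refine setIntegral_congr_fun measurableSet_Ioi fun x hx => ?_
  simp only [toReal_weight hx]

theorem moment {α : ℝ} (hα : -1 < α) (k : ℕ) :
    Integrable (fun x : ℝ => x ^ k) (weightMeasure α) ∧
      ∫ x, x ^ k ∂(weightMeasure α) = Real.Gamma (α + k + 1) := by
  have hk : 0 < α + k + 1 := by
    have : (0 : ℝ) ≤ k := by positivity
    linarith
  have h : Set.EqOn (fun x : ℝ => Real.exp (-x) * x ^ (α + k + 1 - 1))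
      (fun x : ℝ => (Real.exp (-x) * x ^ α) • x ^ k) (Set.Ioi 0) := fun x hx => by
    simp only [add_sub_cancel_right, smul_eq_mul]
    rw [Real.rpow_add hx, Real.rpow_natCast, mul_assoc]
  rw [integrable_weightMeasure_iff, integral_weightMeasure, Real.Gamma_eq_integral hk,
    ← integrableOn_congr_fun h measurableSet_Ioi, ← setIntegral_congr_fun measurableSet_Ioi h]
  exact ⟨Real.GammaIntegral_convergent hk, rfl⟩

theorem memLp_pow {α : ℝ} (hα : -1 < α) (k : ℕ) :
    MemLp (fun x : ℝ => x ^ k) 2 (weightMeasure α) := by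
  rw [memLp_two_iff_integrable_sq (by fun_prop)]
  simpa only [← pow_mul] using (moment hα (k * 2)).1

theorem laguerreReal_eq (α : ℝ) (n : ℕ) : laguerreReal α n = fun x =>
    ∑ j ∈ Finset.range (n + 1),
      ((-1) ^ j / j.factorial * (rising (α + j + 1) (n - j) / (n - j).factorial)) * x ^ j := by
  funext x
  refine Finset.sum_congr rfl fun j _ => ?_
  rw [neg_pow x]; ring

theorem memLp_laguerreReal {α : ℝ} (hα : -1 < α) (n : ℕ) :
    MemLp (laguerreReal α n) 2 (weightMeasure α) := by
  rw [laguerreReal_eq]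
  exact memLp_finsetSum _ fun j _ => (memLp_pow hα j).const_mul _

/-- Termwise Gamma integrals reduce this to Chu–Vandermonde with `x = α + 1 + k`, `a = α + 1`. The
factor `(-k)ₙ` vanishes for `k < n`, which is orthogonality to lower powers. -/
theorem integral_pow_mul_laguerreReal {α : ℝ} (hα : -1 < α) (k n : ℕ) :
    ∫ x, x ^ k * laguerreReal α n x ∂(weightMeasure α) =
      Real.Gamma (α + k + 1) * rising (-k) n / n.factorial := by
  rw [laguerreReal_eq]
  simp_rw [Finset.mul_sum]
  rw [integral_finsetSum]
  swap
  · exact fun j _ =>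
      (memLp_pow hα k).integrable_mul ((memLp_pow hα j).const_mul _)
  have hk : 0 < α + 1 + k := by
    have : (0 : ℝ) ≤ k := by positivity
    linarith
  have h := sum_choose_rising n (α + 1 + k) (α + 1)
  rw [sub_add_cancel_left] at h
  rw [← h, Finset.mul_sum, Finset.sum_div]
  refine Finset.sum_congr rfl fun j hj => ?_
  have hj : j ≤ n := by simpa [Nat.lt_succ_iff] using hj
  have e : ∀ x : ℝ, x ^ k * ((-1) ^ j / j.factorial *
      (rising (α + j + 1) (n - j) / (n - j).factorial) * x ^ j) =
      ((-1) ^ j / j.factorial * (rising (α + j + 1) (n - j) / (n - j).factorial)) * x ^ (k + j) :=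
    fun x => by rw [pow_add]; ring
  simp_rw [e]
  rw [integral_const_mul, (moment hα _).2, show α + ((k + j : ℕ) : ℝ) + 1 = α + 1 + k + j by
    push_cast; ring, Gamma_add_natCast hk, Nat.cast_choose ℝ hj, add_right_comm α (k : ℝ),
    add_right_comm α (j : ℝ)]
  field_simp

theorem integral_laguerreReal_mul_of_le {α : ℝ} (hα : -1 < α) {m n : ℕ} (hmn : m ≤ n) :
    ∫ x, laguerreReal α m x * laguerreReal α n x ∂(weightMeasure α) =
      if m = n then Real.Gamma (α + n + 1) / n.factorial else 0 := by
  rw [laguerreReal_eq α m]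
  simp_rw [Finset.sum_mul, mul_assoc]
  rw [integral_finsetSum]
  swap
  · exact fun j _ =>
      ((memLp_pow hα j).integrable_mul (memLp_laguerreReal hα n)).const_mul _ |>.const_mul _
  simp_rw [integral_const_mul, integral_pow_mul_laguerreReal hα]
  rw [Finset.sum_range_succ, Finset.sum_eq_zero, zero_add]
  · split_ifs with h
    · subst h
      rw [rising_neg_natCast m m le_rfl]
      have : ((-1 : ℝ) ^ m) ^ 2 = 1 := by rw [← pow_mul, mul_comm, pow_mul]; norm_num
      simp
      field_simp
      rw [this, one_mul]
    · rw [rising_neg_natCast_of_lt (by omega)]; simp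
  · intro j hj
    rw [rising_neg_natCast_of_lt (by have := Finset.mem_range.1 hj; omega)]; simp

theorem integral_laguerreReal_mul {α : ℝ} (hα : -1 < α) (m n : ℕ) :
    ∫ x, laguerreReal α m x * laguerreReal α n x ∂(weightMeasure α) =
      if m = n then Real.Gamma (α + n + 1) / n.factorial else 0 := by
  rcases le_total m n with h | h
  · exact integral_laguerreReal_mul_of_le hα h
  · simp_rw [mul_comm (laguerreReal α m _)]
    rw [integral_laguerreReal_mul_of_le hα h]
    by_cases e : m = n
    · subst e; simp
    · rw [if_neg e, if_neg (Ne.symm e)]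

theorem integral_laguerreReal_mul_sum {α : ℝ} (hα : -1 < α) (a : ℕ → ℝ) (s : Finset ℕ) (m : ℕ) :
    ∫ x, laguerreReal α m x * ∑ n ∈ s, a n * laguerreReal α n x ∂(weightMeasure α) =
      if m ∈ s then a m * (Real.Gamma (α + m + 1) / m.factorial) else 0 := by
  simp_rw [Finset.mul_sum]
  rw [integral_finsetSum]
  swap
  · exact fun n _ =>
      (memLp_laguerreReal hα m).integrable_mul ((memLp_laguerreReal hα n).const_mul _)
  simp_rw [mul_left_comm _ (a _), integral_const_mul, integral_laguerreReal_mul hα]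
  simp

theorem memLp_sum_laguerreReal {α : ℝ} (hα : -1 < α) (a : ℕ → ℝ) (s : Finset ℕ) :
    MemLp (fun x => ∑ n ∈ s, a n * laguerreReal α n x) 2 (weightMeasure α) :=
  memLp_finsetSum _ fun n _ => (memLp_laguerreReal hα n).const_mul _

theorem integral_sum_laguerreReal_sq {α : ℝ} (hα : -1 < α) (a : ℕ → ℝ) (s : Finset ℕ) :
    ∫ x, (∑ n ∈ s, a n * laguerreReal α n x) ^ 2 ∂(weightMeasure α) =
      ∑ n ∈ s, a n ^ 2 * (Real.Gamma (α + n + 1) / n.factorial) := by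
  simp_rw [sq (∑ n ∈ s, _)]
  conv_lhs =>
    enter [2, x]
    rw [Finset.sum_mul]
  rw [integral_finsetSum]
  swap
  · exact fun m _ =>
      ((memLp_laguerreReal hα m).const_mul _).integrable_mul (memLp_sum_laguerreReal hα a s)
  refine Finset.sum_congr rfl fun m hm => ?_
  simp_rw [mul_assoc (a m)]
  rw [integral_const_mul, integral_laguerreReal_mul_sum hα, if_pos hm]
  ring

theorem eLpNorm_sum_laguerreReal_le {α : ℝ} (hα : -1 < α) (a : ℕ → ℝ) (s : Finset ℕ) {B : ℝ}
    (hB : ∑ n ∈ s, a n ^ 2 * (Real.Gamma (α + n + 1) / n.factorial) ≤ B) :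
    eLpNorm (fun x => ∑ n ∈ s, a n * laguerreReal α n x) 2 (weightMeasure α) ≤
      ENNReal.ofReal (√B) := by
  rw [(memLp_sum_laguerreReal hα a s).eLpNorm_eq_integral_rpow_norm (by simp) (by simp)]
  refine ENNReal.ofReal_le_ofReal ?_
  rw [ENNReal.toReal_ofNat, ← one_div, ← Real.sqrt_eq_rpow]
  refine Real.sqrt_le_sqrt (le_trans (le_of_eq ?_) hB)
  simp [← integral_sum_laguerreReal_sq hα]

/-- Fatou's lemma: pointwise limits do not increase an eventual norm bound. -/
theorem eLpNorm_le_of_tendsto_of_le {X : Type*} [MeasurableSpace X] {μ : Measure X}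
    {f : ℕ → X → ℝ} (hf : ∀ n, AEStronglyMeasurable (f n) μ) {g : X → ℝ}
    (hfg : ∀ x, Tendsto (fun n => f n x) atTop (𝓝 (g x))) {p B : ENNReal}
    (hB : ∀ᶠ n in atTop, eLpNorm (f n) p μ ≤ B) : eLpNorm g p μ ≤ B :=
  (Lp.eLpNorm_lim_le_liminf_eLpNorm hf g (ae_of_all _ hfg)).trans
    ((liminf_le_liminf hB).trans_eq (liminf_const B))

/-! ### Convergence in the mean -/

/-- The closed form of the series at a real argument. -/
noncomputable def closedReal (α ρ x : ℝ) : ℝ :=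
  (2 : ℝ) ^ ρ * (Real.Gamma (ρ + α + 1) / Real.Gamma (α + 1)) * kummerReal (-ρ) (α + 1) (x / 2)

theorem continuous_closedReal {α : ℝ} (hα : -1 < α) (ρ : ℝ) : Continuous (closedReal α ρ) :=
  continuous_const.mul ((continuous_kummerReal _ (by linarith)).comp (continuous_id.div_const 2))

/-- Two nested uses of Fatou with a bound independent of the dilation. The case `N = 0` also yields
membership in the weighted space. -/
theorem eLpNorm_closedReal_sub_le {α ρ : ℝ} (hρ : ∀ m : ℕ, ρ ≠ m) (hα : -1 < α)
    (hαρ : -1 < α + 2 * ρ) (N : ℕ) :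
    eLpNorm (fun x => closedReal α ρ x - ∑ n ∈ Finset.range N, coeffG α ρ n * laguerreReal α n x) 2
      (weightMeasure α) ≤ ENNReal.ofReal (√(∑' n : ℕ, coeffG α ρ (n + N) ^ 2 *
        (Real.Gamma (α + ((n + N : ℕ) : ℝ) + 1) / (n + N).factorial))) := by
  have hsum := summable_coeffG_sq hρ hα hαρ
  set u : ℕ → ℝ := fun n => coeffG α ρ n ^ 2 * (Real.Gamma (α + n + 1) / n.factorial) with hu
  have hG : ∀ n : ℕ, 0 ≤ Real.Gamma (α + n + 1) / n.factorial := fun n => by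
    have : 0 < Real.Gamma (α + n + 1) := Real.Gamma_pos_of_pos (by
      have : (0 : ℝ) ≤ n := by positivity
      linarith)
    positivity
  have hu0 : ∀ n, 0 ≤ u n := fun n => mul_nonneg (sq_nonneg _) (hG n)
  -- A sequence in `[0, 1)` tending to 1, as Fatou is applied along sequences.
  set t : ℕ → ℝ := fun k => 1 - 1 / ((k : ℝ) + 1) with ht
  have ht0 : ∀ k, 0 ≤ t k := fun k => by
    simp only [ht, sub_nonneg]
    rw [div_le_one (by positivity)]; simp
  have ht1 : ∀ k, t k < 1 := fun k => by
    simp only [ht, sub_lt_self_iff]; positivity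
  have htlim : Tendsto t atTop (𝓝 1) := by
    simpa [ht] using (tendsto_one_div_add_atTop_nhds_zero_nat (𝕜 := ℝ)).const_sub 1
  set Ft : ℝ → ℝ → ℝ := fun s x => (1 + s) ^ ρ * (Real.Gamma (ρ + α + 1) / Real.Gamma (α + 1)) *
        kummerReal (-ρ) (α + 1) (x * s / (1 + s))
  have hk := continuous_kummerReal (-ρ) (show 0 < α + 1 by linarith)
  have hcont : ∀ a : ℕ → ℝ, ∀ s : Finset ℕ,
      Continuous fun x => ∑ n ∈ s, a n * laguerreReal α n x := fun a s =>
    continuous_finsetSum _ fun n _ => continuous_const.mul (continuous_laguerreReal α n)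
  refine eLpNorm_le_of_tendsto_of_le (f := fun k x => Ft (t k) x -
    ∑ n ∈ Finset.range N, coeffG α ρ n * t k ^ n * laguerreReal α n x) ?_ ?_ ?_
  · intro k
    refine (Continuous.sub (continuous_const.mul (hk.comp ?_)) (hcont _ _)).aestronglyMeasurable
    exact (continuous_id.mul_const _).div_const _
  · intro x
    have h2 : Tendsto (fun k => 1 + t k) atTop (𝓝 2) := by
      convert htlim.const_add 1 using 2; norm_num
    refine Tendsto.sub ?_ (tendsto_finsetSum _ fun n _ => ?_)
    · refine Tendsto.mul ((h2.rpow_const (Or.inl (by norm_num))).mul_const _) ?_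
      refine (hk.tendsto _).comp ?_
      have h3 := (htlim.const_mul x).div h2 two_ne_zero
      rw [mul_one] at h3
      exact h3
    · simpa using ((htlim.pow n).const_mul (coeffG α ρ n)).mul_const (laguerreReal α n x)
  · refine Eventually.of_forall fun k => ?_
    -- For fixed `t k`, the tail from `N` on is the pointwise limit of finite blocks, whose norms
    -- are known by orthogonality.
    refine eLpNorm_le_of_tendsto_of_le (f := fun M x =>
      ∑ n ∈ Finset.Ico N M, (coeffG α ρ n * t k ^ n) * laguerreReal α n x) ?_ ?_ ?_
    · exact fun M => (hcont _ _).aestronglyMeasurable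
    · intro x
      have h := (hasSum_laguerre_abel hα ρ x (ht0 k) (ht1 k)).tendsto_sum_nat
      refine (h.sub_const _).congr' ?_
      filter_upwards [eventually_ge_atTop N] with M hM
      rw [Finset.sum_Ico_eq_sub _ hM]
    · refine Eventually.of_forall fun M => eLpNorm_sum_laguerreReal_le hα _ _ ?_
      calc ∑ n ∈ Finset.Ico N M, (coeffG α ρ n * t k ^ n) ^ 2 *
              (Real.Gamma (α + n + 1) / n.factorial)
          ≤ ∑ n ∈ Finset.Ico N M, u n := by
            refine Finset.sum_le_sum fun n _ => mul_le_mul_of_nonneg_right ?_ (hG n)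
            rw [mul_pow, ← pow_mul]
            exact mul_le_of_le_one_right (sq_nonneg _) (pow_le_one₀ (ht0 k) (ht1 k).le)
        _ = ∑ n ∈ Finset.range (M - N), u (n + N) := by
            rw [Finset.sum_Ico_eq_sum_range]; simp_rw [add_comm N]
        _ ≤ _ := ((summable_nat_add_iff N).2 hsum).sum_le_tsum _ fun n _ => hu0 _

theorem tendsto_eLpNorm_closedReal_sub {α ρ : ℝ} (hρ : ∀ m : ℕ, ρ ≠ m) (hα : -1 < α)
    (hαρ : -1 < α + 2 * ρ) :
    Tendsto (fun N : ℕ => eLpNorm (fun x => closedReal α ρ x -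
      ∑ n ∈ Finset.range N, coeffG α ρ n * laguerreReal α n x) 2 (weightMeasure α)) atTop (𝓝 0) := by
  refine tendsto_of_tendsto_of_tendsto_of_le_of_le tendsto_const_nhds ?_ (fun _ => zero_le)
    (eLpNorm_closedReal_sub_le hρ hα hαρ)
  have h := tendsto_sum_nat_add fun n : ℕ =>
    coeffG α ρ n ^ 2 * (Real.Gamma (α + n + 1) / n.factorial)
  simpa using ENNReal.tendsto_ofReal h.sqrt

theorem memLp_closedReal {α ρ : ℝ} (hρ : ∀ m : ℕ, ρ ≠ m) (hα : -1 < α)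
    (hαρ : -1 < α + 2 * ρ) : MemLp (closedReal α ρ) 2 (weightMeasure α) :=
  ⟨(continuous_closedReal hα ρ).aestronglyMeasurable, by
    simpa using (eLpNorm_closedReal_sub_le hρ hα hαρ 0).trans_lt ENNReal.ofReal_lt_top⟩

/-- The Laguerre coefficients of the closed form. -/
theorem integral_laguerreReal_mul_closedReal {α ρ : ℝ} (hρ : ∀ m : ℕ, ρ ≠ m) (hα : -1 < α)
    (hαρ : -1 < α + 2 * ρ) (n : ℕ) :
    ∫ x, laguerreReal α n x * closedReal α ρ x ∂(weightMeasure α) =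
      coeffG α ρ n * (Real.Gamma (α + n + 1) / n.factorial) := by
  have hL := memLp_laguerreReal hα n
  have hF := memLp_closedReal hρ hα hαρ
  have hS := memLp_sum_laguerreReal hα (coeffG α ρ)
  have h1 : Tendsto (fun N : ℕ => ∫ x, laguerreReal α n x *
      ∑ m ∈ Finset.range N, coeffG α ρ m * laguerreReal α m x ∂(weightMeasure α)) atTop
      (𝓝 (∫ x, laguerreReal α n x * closedReal α ρ x ∂(weightMeasure α))) := by
    -- Hölder with exponents 2 and 2 turns mean-square convergence into `L¹` convergence of the
    -- products.
    refine tendsto_integral_of_L1' _ (hL.integrable_mul hF).1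
      (Eventually.of_forall fun N => hL.integrable_mul (hS _)) ?_
    have h2 := ENNReal.Tendsto.const_mul (a := eLpNorm (laguerreReal α n) 2 (weightMeasure α))
      (tendsto_eLpNorm_closedReal_sub hρ hα hαρ) (Or.inr hL.2.ne)
    rw [mul_zero] at h2
    refine tendsto_of_tendsto_of_tendsto_of_le_of_le tendsto_const_nhds h2 (fun _ => zero_le)
      fun N => ?_
    refine le_trans (le_of_eq ?_) (eLpNorm_smul_le_mul_eLpNorm (p := 2) (q := 2) (r := 1)
      (hF.sub (hS (Finset.range N))).1 hL.1)
    refine eLpNorm_congr_norm_ae (ae_of_all _ fun x => ?_)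
    simp only [Pi.sub_apply, Pi.smul_apply', smul_eq_mul]
    rw [Pi.mul_apply, ← mul_sub, norm_mul, norm_mul, norm_sub_rev]
  refine tendsto_nhds_unique h1 (tendsto_const_nhds.congr' ?_)
  filter_upwards [eventually_gt_atTop n] with N hN
  rw [integral_laguerreReal_mul_sum hα, if_pos (Finset.mem_range.2 hN)]

theorem coeffG_mul_Gamma_div_factorial {α : ℝ} (hα : -1 < α) (ρ : ℝ) (n : ℕ) :
    coeffG α ρ n * (Real.Gamma (α + n + 1) / n.factorial) =
      Real.Gamma (ρ + α + 1) * ((-1) ^ n * rising (-ρ) n / n.factorial) := by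
  rw [coeffG_eq, add_right_comm α (n : ℝ), Gamma_add_natCast (by linarith)]
  have h1 := (rising_pos (show 0 < α + 1 by linarith) n).ne'
  have h2 := (Real.Gamma_pos_of_pos (show 0 < α + 1 by linarith)).ne'
  field_simp

theorem integrable_and_integral_laguerre_kummer {α ρ : ℝ} (hρ : ∀ m : ℕ, ρ ≠ m) (hα : -1 < α)
    (hαρ : -1 < α + 2 * ρ) (n : ℕ) :
    IntegrableOn (fun x : ℝ => ((Real.exp (-x) * x ^ α : ℝ) : ℂ) * laguerre α n x *
        kummer (-(ρ : ℂ)) ((α : ℂ) + 1) ((x : ℂ) / 2)) (Set.Ioi 0) ∧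
      ∫ x in Set.Ioi (0 : ℝ), ((Real.exp (-x) * x ^ α : ℝ) : ℂ) * laguerre α n x *
        kummer (-(ρ : ℂ)) ((α : ℂ) + 1) ((x : ℂ) / 2) =
        (((-1) ^ n / (2 : ℝ) ^ ρ *
          (Real.Gamma (α + 1) * rising (-ρ) n / n.factorial) : ℝ) : ℂ) := by
  set c : ℝ := (2 : ℝ) ^ ρ * (Real.Gamma (ρ + α + 1) / Real.Gamma (α + 1)) with hc
  have h1 : 0 < Real.Gamma (α + 1) := Real.Gamma_pos_of_pos (by linarith)
  -- Adding `α > -1` and `α + 2ρ > -1` gives `ρ + α + 1 > 0`; hence the normalizing constant `c` can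
  -- be divided out.
  have h2 : 0 < Real.Gamma (ρ + α + 1) := Real.Gamma_pos_of_pos (by linarith)
  have h3 : (0 : ℝ) < 2 ^ ρ := by positivity
  have hc0 : c ≠ 0 := by positivity
  have e : (fun x : ℝ => ((Real.exp (-x) * x ^ α : ℝ) : ℂ) * laguerre α n x *
        kummer (-(ρ : ℂ)) ((α : ℂ) + 1) ((x : ℂ) / 2)) = fun x : ℝ =>
      ((c⁻¹ * ((Real.exp (-x) * x ^ α) • (laguerreReal α n x * closedReal α ρ x)) : ℝ) : ℂ) := by
    funext x
    have hk := ofReal_kummerReal (-ρ) (α + 1) (x / 2)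
    push_cast at hk
    rw [← ofReal_laguerreReal hα, ← hk, closedReal, ← hc, smul_eq_mul, ← Complex.ofReal_mul,
      ← Complex.ofReal_mul]
    congr 1
    field_simp
  rw [e, integral_complex_ofReal, integral_const_mul, ← integral_weightMeasure,
    integral_laguerreReal_mul_closedReal hρ hα hαρ, coeffG_mul_Gamma_div_factorial hα]
  refine ⟨?_, ?_⟩
  · exact (((integrable_weightMeasure_iff α _).1 ((memLp_laguerreReal hα n).integrable_mul
      (memLp_closedReal hρ hα hαρ))).const_mul c⁻¹).ofReal
  · congr 1
    rw [hc]
    field_simp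

theorem laguerreCoeff_closedG {α ρ : ℝ} (hρ : ∀ m : ℕ, ρ ≠ m) (hα : -1 < α)
    (hαρ : -1 < α + 2 * ρ) (n : ℕ) :
    laguerreCoeff α (closedG α ρ) n = (coeffG α ρ n : ℂ) := by
  have e : ∀ x : ℝ, ((Real.exp (-x) * x ^ α : ℝ) : ℂ) * laguerre α n x * closedG α ρ x =
      (((Real.exp (-x) * x ^ α) • (laguerreReal α n x * closedReal α ρ x) : ℝ) : ℂ) := fun x => by
    rw [closedG_ofReal, ← ofReal_laguerreReal hα, smul_eq_mul, closedReal]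
    push_cast; ring
  rw [laguerreCoeff]
  simp_rw [e]
  rw [integral_complex_ofReal, ← integral_weightMeasure,
    integral_laguerreReal_mul_closedReal hρ hα hαρ, ← Complex.ofReal_mul]
  congr 1
  have : Real.Gamma (α + n + 1) ≠ 0 := (Real.Gamma_pos_of_pos (by
    have : (0 : ℝ) ≤ n := by positivity
    linarith)).ne'
  field_simp

end LaguerreSeries

/-! ### The main theorem -/

theorem mainTheorem2 (α ρ : ℝ) (hρ : ∀ m : ℕ, ρ ≠ m) (hα : -1 < α) (hαρ : -1 < α + 2 * ρ) :
    -- the closed form is entire, in particular analytic at the origin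
    (Differentiable ℂ (LaguerreSeries.closedG α ρ) ∧
      AnalyticAt ℂ (LaguerreSeries.closedG α ρ) 0) ∧
    -- it lies in the weighted `L²` space and the series converges to it in the mean
    (MemLp (fun x : ℝ => LaguerreSeries.closedG α ρ x) 2 (LaguerreSeries.weightMeasure α) ∧
      Tendsto (fun N : ℕ => eLpNorm
          (fun x : ℝ => (∑ n ∈ Finset.range N,
            (LaguerreSeries.coeffG α ρ n : ℂ) * LaguerreSeries.laguerre α n x) -
              LaguerreSeries.closedG α ρ x)
          2 (LaguerreSeries.weightMeasure α)) atTop (𝓝 0)) ∧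
    -- the rearrangement of the series into powers of `z`, with Abel summation of the inner
    -- series, is a power series that converges everywhere to the closed form
    (∃ γ : ℕ → ℝ,
      (∀ ν : ℕ, LaguerreSeries.AbelSum
        (fun μ => (ascPochhammer ℝ μ).eval (α + ν + 1) / (μ.factorial : ℝ) *
          LaguerreSeries.coeffG α ρ (μ + ν)) (γ ν)) ∧
      ∀ z : ℂ, HasSum (fun ν : ℕ => (-z) ^ ν / (ν.factorial : ℂ) * (γ ν : ℂ))
        (LaguerreSeries.closedG α ρ z)) ∧
    -- the integrals of the `₁F₁` function against the Laguerre polynomials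
    (∀ n : ℕ,
      IntegrableOn (fun x : ℝ => ((Real.exp (-x) * x ^ α : ℝ) : ℂ) * LaguerreSeries.laguerre α n x *
        LaguerreSeries.kummer (-(ρ : ℂ)) ((α : ℂ) + 1) ((x : ℂ) / 2)) (Set.Ioi 0) ∧
      ∫ x in Set.Ioi (0 : ℝ), ((Real.exp (-x) * x ^ α : ℝ) : ℂ) * LaguerreSeries.laguerre α n x *
        LaguerreSeries.kummer (-(ρ : ℂ)) ((α : ℂ) + 1) ((x : ℂ) / 2) =
        (((-1) ^ n / (2 : ℝ) ^ ρ *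
          (Real.Gamma (α + 1) * (ascPochhammer ℝ n).eval (-ρ) / n.factorial) : ℝ) : ℂ)) ∧
    -- hence the Laguerre coefficients of the closed form are those of the series
    (∀ n : ℕ, LaguerreSeries.laguerreCoeff α (LaguerreSeries.closedG α ρ) n =
      (LaguerreSeries.coeffG α ρ n : ℂ)) ∧
    -- the coefficients are ultimately strictly alternating and decay only algebraically
    (0 < α + ρ + 1 ∧ Real.Gamma (ρ + α + 1) / Real.Gamma (-ρ) ≠ 0 ∧
      Tendsto (fun n : ℕ => (-1) ^ n * LaguerreSeries.coeffG α ρ n * (n : ℝ) ^ (α + ρ + 1)) atTop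
        (𝓝 (Real.Gamma (ρ + α + 1) / Real.Gamma (-ρ)))) := by
  have hpos : 0 < α + ρ + 1 := by linarith
  refine ⟨⟨LaguerreSeries.differentiable_closedG hα ρ,
    (LaguerreSeries.differentiable_closedG hα ρ).analyticAt 0⟩, ⟨?_, ?_⟩,
    -- The Abel sum `γ_ν` is the inner value `λ_ν (1 + t)^(ρ - ν)` at `t = 1`.
    ⟨fun ν => LaguerreSeries.coeffG α ρ ν * 2 ^ (ρ - ν),
      fun ν => LaguerreSeries.abelSum_coeffG hα ρ ν, fun z => ?_⟩,
    fun n => LaguerreSeries.integrable_and_integral_laguerre_kummer hρ hα hαρ n,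
    fun n => LaguerreSeries.laguerreCoeff_closedG hρ hα hαρ n, hpos, ?_,
    LaguerreSeries.tendsto_coeffG hρ hα⟩
  · simp_rw [LaguerreSeries.closedG_ofReal]
    exact (LaguerreSeries.memLp_closedReal hρ hα hαρ).ofReal
  · refine (LaguerreSeries.tendsto_eLpNorm_closedReal_sub hρ hα hαρ).congr fun N =>
      eLpNorm_congr_norm_ae (ae_of_all _ fun x => ?_)
    simp_rw [LaguerreSeries.closedG_ofReal, ← LaguerreSeries.ofReal_laguerreReal hα]
    rw [← Complex.norm_real, norm_sub_rev]
    push_cast [LaguerreSeries.closedReal]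
    rfl
  · have h := LaguerreSeries.hasSum_rearranged hα ρ 2 two_pos z
    convert h using 1
    rw [LaguerreSeries.closedG]
    push_cast
    rfl
  · refine div_ne_zero (Real.Gamma_pos_of_pos (by linarith)).ne' (Real.Gamma_ne_zero fun m h => ?_)
    exact hρ m (by linarith)
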